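/- Let $G$ be a locally compact (Hausdorff) group, let $1<p<\infty$ and let $p'$ be given by $1/p+1/p'=1$. A complex Banach space is a $QSL_{p'}$-space if it is isometrically isomorphic to a quotient of a subspace of some $L^{p'}(X)$, $X$ a measure space. A representation of $G$ on a Banach space $E$ is a homomorphism $\pi$ from $G$ to the group of invertible isometries of $E$ that is continuous for the strong operator topology; it is cyclic if $\{\int_G f(x)\pi(x)v\,dx : f\in L^1(G)\}$ is dense in $E$ for some $v\in E$. Let $B_p(G)$ be the set of all functions $f(x)=\langle \pi(x)\xi,\phi\rangle$ on $G$, where $\pi$ is a representation of $G$ on a $QSL_{p'}$-space $E$, $\xi\in E$ and $\phi\in E^*$, normed by $$\|f\|=\inf\Big\{\sum_{n\in\mathbb N}\|\xi_n\|\,\|\phi_n\| : f(x)=\sum_{n\in\mathbb N}\langle\pi_n(x)\xi_n,\phi_n\rangle\ (x\in G),\ \sum_{n\in\mathbb N}\|\xi_n\|\,\|\phi_n\|<\infty\Big\},$$ where the $\pi_n$ are cyclic representations of $G$ on $QSL_{p'}$-spaces $E_n$, $\xi_n\in E_n$ and $\phi_n\in E_n^*$. For a subgroup $H$ of $G$,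 call $G$ an $[SIN]_H$-group if the identity of $G$ has a neighbourhood base $\mathcal V$ such that $h^{-1}Vh=V$ for all $V\in\mathcal V$ and $h\in H$. Theorem. Let $H$ be a compact subgroup of an $[SIN]_H$-group $G$. Then $u\mapsto u|_H$ maps $B_p(G)$ into $B_p(H)$, and its range is dense in $B_p(H)$: for every $v\in B_p(H)$ and $\varepsilon>0$ there is $u\in B_p(G)$ such that $u|_H-v\in B_p(H)$ and $\|u|_H-v\|_{B_p(H)}<\varepsilon$. -/

import Mathlib

open MeasureTheory Topology
open scoped ENNReal

universe u

namespace FourierStieltjes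

/-- The conjugate exponent `1 + (p - 1)⁻¹` is always at least `1`. -/
instance fact_one_le_conjExponent (p : ℝ≥0∞) : Fact (1 ≤ ENNReal.conjExponent p) :=
  ⟨le_self_add⟩

/-- A complex Banach space is a `QSL_q`-space if it is isometrically isomorphic to a quotient
`S ⧸ N` of a (closed) subspace `S` of some space `L^q(X, μ)` by a closed subspace `N` of `S`. -/
def IsQSL (q : ℝ≥0∞) [Fact (1 ≤ q)] (E : Type u) [NormedAddCommGroup E] [NormedSpace ℂ E] :
    Prop :=
  ∃ (X : Type u) (_ : MeasurableSpace X) (μ : Measure X)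
    (S : Submodule ℂ (Lp ℂ q μ)) (N : Submodule ℂ S),
    IsClosed (S : Set (Lp ℂ q μ)) ∧ IsClosed (N : Set S) ∧ Nonempty (E ≃ₗᵢ[ℂ] (S ⧸ N))

/-- A strongly continuous representation of `G` by invertible isometries of a `QSL_q`-space,
that is, an element of `Rep_q(G)`. The spaces are taken in the universe of `G`.
This is no restriction for coefficient functions: only the closed span of an orbit matters, and
its cardinality is at most `(#G + 2 ^ ℵ₀) ^ ℵ₀`. -/
structure QSLRep (q : ℝ≥0∞) [Fact (1 ≤ q)] (G : Type u) [Group G] [TopologicalSpace G] where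
  /-- the space of the representation -/
  E : Type u
  [normedAddCommGroup : NormedAddCommGroup E]
  [normedSpace : NormedSpace ℂ E]
  [completeSpace : CompleteSpace E]
  isQSL : IsQSL q E
  /-- the action -/
  π : G →* (E ≃ₗᵢ[ℂ] E)
  continuous_orbit : ∀ ξ : E, Continuous fun x : G => π x ξ

attribute [instance] QSLRep.normedAddCommGroup QSLRep.normedSpace QSLRep.completeSpace

/-- The representation is cyclic: for some vector `v`, the set `π(L¹(G)) v` is dense, where
`π(f) v = ∫ f(x) π(x) v dx` with respect to left Haar measure. -/
def QSLRep.IsCyclic {q : ℝ≥0∞} [Fact (1 ≤ q)] {G : Type u} [Group G] [TopologicalSpace G]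
    [IsTopologicalGroup G] [LocallyCompactSpace G] [MeasurableSpace G] [BorelSpace G]
    (R : QSLRep q G) : Prop :=
  ∃ v : R.E, Dense (Set.range fun f : G →₁[Measure.haar (G := G)] ℂ =>
    ∫ x, f x • R.π x v ∂(Measure.haar (G := G)))

/-- The algebra `B_p(G)`: the coefficient functions `x ↦ ⟨π(x) ξ, φ⟩` of representations in
`Rep_{p'}(G)`, where `1/p + 1/p' = 1`. -/
def Bp (p : ℝ≥0∞) (G : Type u) [Group G] [TopologicalSpace G] : Set (G → ℂ) :=
  {f | ∃ (R : QSLRep (ENNReal.conjExponent p) G) (ξ : R.E) (φ : StrongDual ℂ R.E),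
    ∀ x, f x = φ (R.π x ξ)}

/-- The norm of `B_p(G)`: the infimum of `∑ ‖ξ n‖ ‖φ n‖` over all expansions
`f x = ∑ ⟨π n (x) (ξ n), φ n⟩` with cyclic `π n` in `Rep_{p'}(G)` and `∑ ‖ξ n‖ ‖φ n‖ < ∞`.
It is `∞` for functions that have no such expansion. -/
noncomputable def bpNorm (p : ℝ≥0∞) {G : Type u} [Group G] [TopologicalSpace G]
    [IsTopologicalGroup G] [LocallyCompactSpace G] [MeasurableSpace G] [BorelSpace G]
    (f : G → ℂ) : ℝ≥0∞ :=
  sInf {r | ∃ (R : ℕ → QSLRep (ENNReal.conjExponent p) G)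
    (ξ : ∀ n, (R n).E) (φ : ∀ n, StrongDual ℂ (R n).E),
    (∀ n, (R n).IsCyclic) ∧ (Summable fun n => ‖ξ n‖ * ‖φ n‖) ∧
    (∀ x, HasSum (fun n => φ n ((R n).π x (ξ n))) (f x)) ∧
    r = ENNReal.ofReal (∑' n, ‖ξ n‖ * ‖φ n‖)}

/-- `G` is an `[SIN]_H`-group: the identity has a neighbourhood base of sets `V` with
`h⁻¹ V h = V` for all `h ∈ H`. -/
def IsSIN {G : Type u} [Group G] [TopologicalSpace G] (H : Subgroup G) : Prop :=
  ∃ 𝒱 : Set (Set G), (𝓝 (1 : G)).HasBasis (fun V => V ∈ 𝒱) id ∧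
    ∀ V ∈ 𝒱, ∀ h ∈ H, (fun x => h⁻¹ * x * h) '' V = V

end FourierStieltjes

/-!
The restriction of a representation of `G` to `H` is a representation of `H` on the same space,
so restriction maps `B_p(G)` into `B_p(H)`. The content is the density of the range.

Let `v k = φ (π k ξ)` be a coefficient function on the compact group `H`. Using the `[SIN]_H`
condition, choose a bump function `f ≥ 0` in `C_c(G)` with small support around the identity that
is invariant under conjugation by `H` (`exists_conj_invariant_bump`). Consider the coefficient
function
`u x = ∫ f(y) a(x⁻¹ y) dy`, where `a z = ∫_H f(z h) v(h) dh`,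
of the left regular representation of `G` on `L^{p'}(G)` (`integral_mul_mem_Bp`). By Fubini and
the conjugation invariance of `f` and of the Haar measure of `G` (`integral_conj_eq_self`), its
restriction to `H` is
`u k = ∫_H m(h) v(k h) dh = φ (π k η)`, where `m t = ∫ f(y) f(y t) dy` and
`η = ∫_H m(h) π(h) ξ dh` (`exists_density_extend`).
After normalization `m` is a probability density supported near the identity of `H`, so `η` is
close to `ξ`, and `u - v` is on `H` the coefficient function `k ↦ φ (π k (η - ξ))` of the given
representation.

It remains to bound the norm of a coefficient function by `‖ξ‖ ‖φ‖` (`bpNorm_coeff_le`). As the norm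
of `B_p(H)` only admits cyclic representations, one passes to the closure of `π(L¹(H)) ξ`. It
contains `ξ`, because `L¹(H)` has an approximate identity, and it is again a `QSL`-space, because
closed subspaces of `QSL`-spaces are (`IsQSL.of_isClosed_submodule`).
-/

namespace FourierStieltjes

/-! ### Permanence properties of `QSL`-spaces -/

/-- The class of `QSL_q`-spaces is described by metric surjections, which avoids nested
quotients: it suffices that the open unit ball of a closed subspace `S` of `L^q` is mapped
onto the open unit ball of `E`. -/
lemma IsQSL.of_metric_surjection {q : ℝ≥0∞} [Fact (1 ≤ q)] {E : Type u} [NormedAddCommGroup E]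
    [NormedSpace ℂ E] {X : Type u} [MeasurableSpace X] {μ : Measure X}
    (S : Submodule ℂ (Lp ℂ q μ)) (hS : IsClosed (S : Set (Lp ℂ q μ))) (T : S →ₗ[ℂ] E)
    (hT : ∀ s, ‖T s‖ ≤ ‖s‖) (hT' : ∀ e, ∀ ε > 0, ∃ s, T s = e ∧ ‖s‖ < ‖e‖ + ε) :
    IsQSL q E := by
  have hsurj : Function.Surjective T := fun e => by
    obtain ⟨s, hs, -⟩ := hT' e 1 one_pos
    exact ⟨s, hs⟩
  have hcont : Continuous T :=
    (T.mkContinuous 1 fun s => by simpa using hT s).continuous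
  refine ⟨X, _, μ, S, LinearMap.ker T, hS, ?_, ⟨LinearIsometryEquiv.symm ?_⟩⟩
  · exact isClosed_singleton.preimage hcont
  · refine ⟨T.quotKerEquivOfSurjective hsurj, fun x => ?_⟩
    refine le_antisymm (le_of_forall_pos_le_add fun ε hε => ?_)
      (le_of_forall_pos_le_add fun ε hε => ?_)
    · obtain ⟨s, rfl, hs⟩ := Submodule.Quotient.norm_mk_lt x hε
      exact (hT s).trans hs.le
    · obtain ⟨s, hs, hs'⟩ := hT' (T.quotKerEquivOfSurjective hsurj x) ε hε
      have : x = Submodule.Quotient.mk s := by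
        apply (T.quotKerEquivOfSurjective hsurj).injective
        rw [← hs]
        rfl
      calc ‖x‖ ≤ ‖s‖ := by rw [this]; exact Submodule.Quotient.norm_mk_le _ s
        _ ≤ _ := hs'.le

lemma isQSL_Lp {q : ℝ≥0∞} [Fact (1 ≤ q)] {X : Type u} [MeasurableSpace X] (μ : Measure X) :
    IsQSL q (Lp ℂ q μ) :=
  .of_metric_surjection ⊤ isClosed_univ (Submodule.subtype ⊤) (fun _ => le_rfl)
    fun e _ hε => ⟨⟨e, trivial⟩, rfl, lt_add_of_pos_right _ hε⟩

lemma IsQSL.of_isClosed_submodule {q : ℝ≥0∞} [Fact (1 ≤ q)] {E : Type u} [NormedAddCommGroup E]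
    [NormedSpace ℂ E] (hE : IsQSL q E) (F : Submodule ℂ E) (hF : IsClosed (F : Set E)) :
    IsQSL q F := by
  obtain ⟨X, _, μ, S, N, hS, hN, ⟨e⟩⟩ := hE
  -- if `T : S → E` is the quotient map, then `F` is a metric quotient of `T⁻¹ F`
  let T : S →ₗ[ℂ] E := e.symm.toLinearEquiv.toLinearMap ∘ₗ N.mkQ
  have hT (s : S) : ‖T s‖ ≤ ‖s‖ :=
    (e.symm.norm_map _).trans_le (Submodule.Quotient.norm_mk_le _ s)
  have hcont : Continuous T :=
    (T.mkContinuous 1 fun s => by simpa using hT s).continuous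
  have hmem (s : (F.comap T).map S.subtype) : ∃ h : (s : Lp ℂ q μ) ∈ S, T ⟨s, h⟩ ∈ F := by
    obtain ⟨s, t, ht, rfl⟩ := s
    exact ⟨t.2, ht⟩
  let T' : (F.comap T).map S.subtype →ₗ[ℂ] F :=
    (T ∘ₗ Submodule.inclusion (Submodule.map_subtype_le S _)).codRestrict F fun s => (hmem s).2
  refine .of_metric_surjection ((F.comap T).map S.subtype) ?_ T' (fun s => hT _) ?_
  · exact hS.isClosedEmbedding_subtypeVal.isClosedMap _ (hF.preimage hcont)
  · intro x ε hε
    obtain ⟨s, hs, hs'⟩ := Submodule.Quotient.norm_mk_lt (e x) hε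
    have hTs : T s = x := by
      change e.symm (Submodule.Quotient.mk s) = x
      rw [hs, e.symm_apply_apply]
    refine ⟨⟨s, s, ?_, rfl⟩, Subtype.ext hTs, ?_⟩
    · simp [hTs]
    · rw [e.norm_map] at hs'
      exact hs'

/-! ### Constructions of representations -/

/-- The isometric representation given by a multiplicative family of norm-preserving linear
maps. -/
noncomputable def isometryHom {K E : Type*} [Group K] [NormedAddCommGroup E] [NormedSpace ℂ E]
    (A : K → E →ₗ[ℂ] E) (h1 : A 1 = LinearMap.id) (hmul : ∀ x y, A (x * y) = A x ∘ₗ A y)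
    (hA : ∀ x ξ, ‖A x ξ‖ = ‖ξ‖) : K →* (E ≃ₗᵢ[ℂ] E) where
  toFun x := ⟨LinearEquiv.ofLinearMap (A x) (A x⁻¹) (by rw [← hmul, mul_inv_cancel, h1])
    (by rw [← hmul, inv_mul_cancel, h1]), hA x⟩
  map_one' := by ext ξ; exact congr($h1 ξ)
  map_mul' x y := by ext ξ; exact congr($(hmul x y) ξ)

namespace QSLRep

variable {q : ℝ≥0∞} [Fact (1 ≤ q)] {K : Type u} [Group K] [TopologicalSpace K]

/-- The restriction of a representation to a closed invariant subspace. -/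
noncomputable def sub (R : QSLRep q K) (F : Submodule ℂ R.E) (hF : IsClosed (F : Set R.E))
    (hinv : ∀ k, ∀ ξ ∈ F, R.π k ξ ∈ F) : QSLRep q K where
  E := F
  completeSpace := hF.completeSpace_coe
  isQSL := R.isQSL.of_isClosed_submodule F hF
  π := isometryHom (fun k => (R.π k).toLinearEquiv.toLinearMap.restrict (hinv k))
    (by ext ξ; simp) (fun x y => by ext ξ; simp) (fun x ξ => (R.π x).norm_map ξ)
  continuous_orbit ξ := (R.continuous_orbit ξ).subtype_mk _

/-- The restriction of a representation to a subgroup. -/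
noncomputable def restrict (R : QSLRep q K) (H : Subgroup K) : QSLRep q H where
  E := R.E
  isQSL := R.isQSL
  π := R.π.comp H.subtype
  continuous_orbit ξ := (R.continuous_orbit ξ).comp continuous_subtype_val

/-- The left regular representation on `L^q`, `(x • F) y = F (x⁻¹ y)`. -/
noncomputable def leftRegular [IsTopologicalGroup K] [LocallyCompactSpace K]
    [MeasurableSpace K] [BorelSpace K] (hq : q ≠ ∞) : QSLRep q K where
  E := Lp ℂ q (Measure.haar (G := K))
  isQSL := isQSL_Lp _
  π := isometryHom
    (fun x => DistribSMul.toLinearMap ℂ _ (DomMulAct.mk x⁻¹))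
    (by ext1 F; simp)
    (fun x y => by ext1 F; simp [mul_smul])
    (fun x F => DomMulAct.norm_smul_Lp _ F)
  continuous_orbit F := by
    have : Fact (q ≠ ∞) := ⟨hq⟩
    have : Continuous fun x : K => DomMulAct.mk x⁻¹ • F :=
      (DomMulAct.continuous_mk.comp continuous_inv).smul continuous_const
    exact this

end QSLRep

/-! ### Cyclic subspaces over compact groups -/

namespace QSLRep

variable {q : ℝ≥0∞} [Fact (1 ≤ q)] {K : Type u} [Group K] [TopologicalSpace K]

lemma tendsto_norm_orbit_sub (R : QSLRep q K) (ξ : R.E) :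
    Filter.Tendsto (fun k => ‖R.π k ξ - ξ‖) (𝓝 1) (𝓝 0) := by
  have := ((R.continuous_orbit ξ).sub (continuous_const (y := ξ))).norm.tendsto 1
  simpa using this

variable [MeasurableSpace K] [BorelSpace K] [CompactSpace K]

lemma integrable_smul_orbit (R : QSLRep q K) {μ : Measure K} {f : K → ℂ} (hf : Integrable f μ)
    (ξ : R.E) : Integrable (fun k => f k • R.π k ξ) μ :=
  hf.smul_of_top_left <| memLp_top_of_bound
    (R.continuous_orbit ξ).aestronglyMeasurable_of_compactSpace ‖ξ‖ (by simp)

/-- Averaging an orbit against a probability density concentrated near the identity moves the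
vector very little. -/
lemma norm_integral_smul_sub_le (R : QSLRep q K) {μ : Measure K} {m : K → ℝ}
    (hm : Integrable m μ) (hm0 : 0 ≤ m) (hm1 : ∫ k, m k ∂μ = 1) (ξ : R.E) {δ : ℝ}
    (hδ : ∀ k, m k ≠ 0 → ‖R.π k ξ - ξ‖ ≤ δ) :
    ‖∫ k, (m k : ℂ) • R.π k ξ ∂μ - ξ‖ ≤ δ := by
  have hξ : ∫ k, (m k : ℂ) • ξ ∂μ = ξ := by
    rw [integral_smul_const, integral_complex_ofReal, hm1, Complex.ofReal_one, one_smul]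
  have hm' : Integrable (fun k => (m k : ℂ)) μ := hm.ofReal
  calc ‖∫ k, (m k : ℂ) • R.π k ξ ∂μ - ξ‖
      = ‖∫ k, (m k : ℂ) • (R.π k ξ - ξ) ∂μ‖ := by
        simp_rw [smul_sub]
        rw [integral_sub (R.integrable_smul_orbit hm' ξ) (hm'.smul_const ξ), hξ]
    _ ≤ ∫ k, m k * δ ∂μ := by
        refine norm_integral_le_of_norm_le (hm.mul_const δ) (.of_forall fun k => ?_)
        rw [norm_smul, Complex.norm_real, Real.norm_of_nonneg (hm0 k)]
        rcases eq_or_ne (m k) 0 with h | h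
        · simp [h]
        · exact mul_le_mul_of_nonneg_left (hδ k h) (hm0 k)
    _ = δ := by rw [integral_mul_const, hm1, one_mul]

variable [IsTopologicalGroup K] [T2Space K]

/-- The linear map `f ↦ π(f) ξ` on `L¹(K)`. -/
noncomputable def integrated (R : QSLRep q K) (ξ : R.E) :
    (K →₁[Measure.haar (G := K)] ℂ) →ₗ[ℂ] R.E where
  toFun f := ∫ k, f k • R.π k ξ ∂Measure.haar
  map_add' f g := by
    rw [← integral_add (R.integrable_smul_orbit (L1.integrable_coeFn f) ξ)
      (R.integrable_smul_orbit (L1.integrable_coeFn g) ξ)]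
    refine integral_congr_ae ?_
    filter_upwards [Lp.coeFn_add f g] with k hk
    rw [hk, Pi.add_apply, add_smul]
  map_smul' c f := by
    rw [RingHom.id_apply, ← integral_smul]
    refine integral_congr_ae ?_
    filter_upwards [Lp.coeFn_smul c f] with k hk
    rw [hk, Pi.smul_apply, smul_assoc]

lemma integrated_toL1 (R : QSLRep q K) (ξ : R.E) {f : K → ℂ} (hf : Integrable f Measure.haar) :
    R.integrated ξ (hf.toL1 f) = ∫ k, f k • R.π k ξ ∂Measure.haar :=
  integral_congr_ae <| by filter_upwards [hf.coeFn_toL1] with k hk; rw [hk]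

lemma map_integrated_mem_range (R : QSLRep q K) (ξ : R.E) (x : K)
    (f : K →₁[Measure.haar (G := K)] ℂ) :
    R.π x (R.integrated ξ f) ∈ LinearMap.range (R.integrated ξ) := by
  have hf : Integrable (fun k => f (x⁻¹ * k)) Measure.haar :=
    (L1.integrable_coeFn f).comp_mul_left x⁻¹
  refine ⟨hf.toL1 _, ?_⟩
  calc R.integrated ξ (hf.toL1 _) = ∫ k, f (x⁻¹ * k) • R.π k ξ ∂Measure.haar :=
        R.integrated_toL1 ξ hf
    _ = ∫ k, f k • R.π x (R.π k ξ) ∂Measure.haar := by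
        rw [← integral_mul_left_eq_self _ x]
        simp
    _ = R.π x (R.integrated ξ f) := by
        have := (R.π x).toContinuousLinearEquiv.toContinuousLinearMap.integral_comp_comm
          (R.integrable_smul_orbit (L1.integrable_coeFn f) ξ)
        simpa [integrated] using this

/-- Normalized indicator functions of small neighbourhoods of the identity form an approximate
identity. -/
lemma mem_closure_range_integrated (R : QSLRep q K) (ξ : R.E) :
    ξ ∈ closure (Set.range (R.integrated ξ)) := by
  refine Metric.mem_closure_iff.2 fun ε hε => ?_
  obtain ⟨U, hU, hUo, h1⟩ := eventually_nhds_iff.1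
    ((R.tendsto_norm_orbit_sub ξ).eventually_lt_const (half_pos hε))
  have hpos : 0 < Measure.haar.real U :=
    ENNReal.toReal_pos (hUo.measure_pos _ ⟨1, h1⟩).ne' (measure_ne_top _ _)
  have hm : Integrable (U.indicator fun _ => (Measure.haar.real U)⁻¹) (Measure.haar (G := K)) :=
    (integrable_const _).indicator hUo.measurableSet
  refine ⟨_, ⟨hm.ofReal.toL1 _, rfl⟩, ?_⟩
  rw [integrated_toL1, dist_comm, dist_eq_norm]
  refine (R.norm_integral_smul_sub_le hm ?_ ?_ ξ (δ := ε / 2) fun k hk => ?_).trans_lt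
    (half_lt_self hε)
  · exact fun k => Set.indicator_nonneg (fun _ _ => by positivity) k
  · rw [integral_indicator_const _ hUo.measurableSet, smul_eq_mul, mul_inv_cancel₀ hpos.ne']
  · exact (hU k (Set.mem_of_indicator_ne_zero hk)).le

/-- Every vector lies in a closed invariant subspace for which it is cyclic. -/
lemma exists_sub_isCyclic (R : QSLRep q K) (ξ : R.E) :
    ∃ (F : Submodule ℂ R.E) (hF : IsClosed (F : Set R.E)) (hinv : ∀ k, ∀ η ∈ F, R.π k η ∈ F),
      ξ ∈ F ∧ (R.sub F hF hinv).IsCyclic := by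
  let F := (LinearMap.range (R.integrated ξ)).topologicalClosure
  have hF : IsClosed (F : Set R.E) := Submodule.isClosed_topologicalClosure _
  have hinv : ∀ k, ∀ η ∈ F, R.π k η ∈ F := fun k η hη =>
    map_mem_closure (R.π k).continuous hη <| by
      rintro _ ⟨f, rfl⟩
      exact R.map_integrated_mem_range ξ k f
  have hξ : ξ ∈ F := R.mem_closure_range_integrated ξ
  have : CompleteSpace F := hF.completeSpace_coe
  let T : (K →₁[Measure.haar (G := K)] ℂ) → F := (R.sub F hF hinv).integrated (⟨ξ, hξ⟩ : F)
  have hT : ∀ f, (T f : R.E) = R.integrated ξ f := fun f =>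
    (F.subtypeL.integral_comp_comm ((R.sub F hF hinv).integrable_smul_orbit
      (L1.integrable_coeFn f) (⟨ξ, hξ⟩ : F))).symm
  have hdense : Dense (Set.range T) := fun η => by
    have hη : (η : R.E) ∈ closure (Set.range (R.integrated ξ)) := η.2
    refine closure_subtype.2 (closure_mono ?_ hη)
    rintro _ ⟨f, rfl⟩
    exact ⟨_, ⟨f, rfl⟩, hT f⟩
  exact ⟨F, hF, hinv, hξ, (⟨ξ, hξ⟩ : F), hdense⟩

end QSLRep

/-- On a compact group, a coefficient function has norm at most `‖ξ‖ ‖φ‖`, whether or not the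
representation is cyclic. -/
lemma bpNorm_coeff_le {K : Type u} [Group K] [TopologicalSpace K] [IsTopologicalGroup K]
    [CompactSpace K] [T2Space K] [MeasurableSpace K] [BorelSpace K] {p : ℝ≥0∞}
    (R : QSLRep (ENNReal.conjExponent p) K) (ξ : R.E) (φ : StrongDual ℂ R.E) :
    bpNorm p (fun k => φ (R.π k ξ)) ≤ ENNReal.ofReal (‖ξ‖ * ‖φ‖) := by
  obtain ⟨F, hF, hinv, hξ, hcyc⟩ := R.exists_sub_isCyclic ξ
  let φ' : StrongDual ℂ F := φ.comp F.subtypeL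
  have hφ' : ‖φ'‖ ≤ ‖φ‖ := φ'.opNorm_le_bound (norm_nonneg _) fun x => φ.le_opNorm x
  let ξ' : F := ⟨ξ, hξ⟩
  -- the expansion with a single nonzero term
  have hs : HasSum (fun n : ℕ => ‖if n = 0 then ξ' else 0‖ * ‖φ'‖) (‖ξ'‖ * ‖φ'‖) := by
    convert hasSum_ite_eq (0 : ℕ) (‖ξ'‖ * ‖φ'‖) using 2 with n
    split_ifs <;> simp
  rw [bpNorm]
  refine sInf_le_of_le ⟨fun _ => R.sub F hF hinv, fun n => if n = 0 then ξ' else (0 : F),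
    fun _ => φ', fun _ => hcyc, hs.summable, fun k => ?_, rfl⟩ ?_
  · convert hasSum_ite_eq (0 : ℕ) (φ (R.π k ξ)) using 2 with n
    rcases n with _ | n
    · rfl
    · exact (congrArg φ' (map_zero ((R.sub F hF hinv).π k))).trans (map_zero φ')
  · refine ENNReal.ofReal_le_ofReal (le_of_eq_of_le hs.tsum_eq ?_)
    exact mul_le_mul_of_nonneg_left hφ' (norm_nonneg ξ)

/-! ### Extending averaged functions from a compact subgroup -/

section Extension

variable {G : Type u} [Group G] [TopologicalSpace G] [IsTopologicalGroup G]
  [LocallyCompactSpace G] [MeasurableSpace G] [BorelSpace G]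

/-- Left Haar measure is invariant under conjugation by `k` as soon as it is so on a single
nonzero positive function, since the two measures are proportional. -/
lemma integral_conj_eq_self {f : G → ℝ} (hf : Continuous f) (hfc : HasCompactSupport f)
    (hf0 : 0 ≤ f) (hf1 : f 1 ≠ 0) {k : G} (hk : ∀ y, f (k * y * k⁻¹) = f y) {g : G → ℝ}
    (hg : Continuous g) (hgc : HasCompactSupport g) :
    ∫ y, g (k * y * k⁻¹) ∂Measure.haar = ∫ y, g y ∂Measure.haar := by
  obtain ⟨c, hc⟩ := Measure.exists_integral_isMulLeftInvariant_eq_smul_of_hasCompactSupport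
    (Measure.map (· * k⁻¹) Measure.haar) (Measure.haar (G := G))
  have hc' : ∀ g : G → ℝ, Continuous g → HasCompactSupport g →
      ∫ y, g (k * y * k⁻¹) ∂Measure.haar = c • ∫ y, g y ∂Measure.haar := fun g hg hgc => by
    rw [← integral_smul_nnreal_measure, ← hc g hg hgc,
      (measurableEmbedding_mulRight k⁻¹).integral_map,
      ← integral_mul_left_eq_self (fun y => g (y * k⁻¹)) k]
  -- testing on `f` shows that the factor of proportionality is `1`
  have hpos : 0 < ∫ y, f y ∂Measure.haar :=
    hf.integral_pos_of_hasCompactSupport_nonneg_nonzero hfc hf0 hf1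
  have hc1 : c = 1 := by
    have := hc' f hf hfc
    simp only [hk] at this
    rw [NNReal.smul_def, smul_eq_mul] at this
    exact_mod_cast (mul_eq_right₀ hpos.ne').1 this.symm
  simpa [hc1] using hc' g hg hgc

/-- Coefficients of the left regular representation: convolutions of functions in `C_c(G)` lie in
`B_p(G)`. -/
lemma integral_mul_mem_Bp {p : ℝ≥0∞} (hp : 1 < p) {a b : G → ℂ} (ha : Continuous a)
    (hac : HasCompactSupport a) (hb : Continuous b) (hbc : HasCompactSupport b) :
    (fun x => ∫ y, b y * a (x⁻¹ * y) ∂Measure.haar) ∈ Bp p G := by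
  have hq : ENNReal.conjExponent p ≠ ∞ := by
    simpa [ENNReal.conjExponent] using (tsub_pos_of_lt hp).ne'
  have : Fact (1 ≤ p) := ⟨hp.le⟩
  have ha' := ha.memLp_of_hasCompactSupport (p := ENNReal.conjExponent p)
    (μ := Measure.haar) hac
  have hb' := hb.memLp_of_hasCompactSupport (p := p) (μ := Measure.haar) hbc
  let L : StrongDual ℂ (Lp ℂ (ENNReal.conjExponent p) (Measure.haar (G := G))) :=
    (ContinuousLinearMap.mul ℂ ℂ).lpPairing Measure.haar p _ (hb'.toLp b)
  have hL : ∀ x : G, ∫ y, b y * a (x⁻¹ * y) ∂Measure.haar =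
      L (DomMulAct.mk x⁻¹ • ha'.toLp a) := fun x => by
    rw [DomMulAct.mk_smul_toLp, ContinuousLinearMap.lpPairing_eq_integral]
    refine integral_congr_ae ?_
    filter_upwards [hb'.coeFn_toLp, (MemLp.coeFn_toLp (f := fun y => a (x⁻¹ • y))
      (ha'.comp_measurePreserving (measurePreserving_smul _ _)))] with y h1 h2
    rw [h1, h2, smul_eq_mul, ContinuousLinearMap.mul_apply']
  exact ⟨.leftRegular hq, ha'.toLp a, L, hL⟩

variable [T2Space G]

/-- Averaging a bump function over the conjugates by a compact subgroup `H`. The `[SIN]_H`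
condition keeps the support small, which is expressed through quotients `y⁻¹ (y t)` of points of
the support. -/
lemma exists_conj_invariant_bump (H : Subgroup G) [CompactSpace H] (hH : IsSIN H) {W : Set G}
    (hW : W ∈ 𝓝 1) :
    ∃ f : G → ℝ, Continuous f ∧ HasCompactSupport f ∧ 0 ≤ f ∧ f 1 ≠ 0 ∧
      (∀ (h : H) y, f (h * y * (h : G)⁻¹) = f y) ∧ ∀ y t, f y ≠ 0 → f (y * t) ≠ 0 → t ∈ W := by
  have hW' : (fun z : G × G => z.1⁻¹ * z.2) ⁻¹' W ∈ 𝓝 ((1 : G), (1 : G)) := by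
    refine ContinuousAt.preimage_mem_nhds (by fun_prop) ?_
    simpa using hW
  rw [nhds_prod_eq, Filter.mem_prod_same_iff] at hW'
  obtain ⟨W₁, hW₁, hW₁'⟩ := hW'
  obtain ⟨𝒱, h𝒱, hconj⟩ := hH
  obtain ⟨V, hV, hVW⟩ := h𝒱.mem_iff.1 hW₁
  have hV1 : V ∈ 𝓝 (1 : G) := h𝒱.mem_of_mem hV
  obtain ⟨f₀, hf₀1, hf₀0, hf₀c, hf₀I⟩ := exists_continuous_one_zero_of_isCompact
    (isCompact_singleton (x := (1 : G))) (isOpen_interior (s := V)).isClosed_compl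
    (by simpa [mem_interior_iff_mem_nhds] using hV1)
  have hF : Continuous fun z : G × H => f₀ ((z.2 : G)⁻¹ * z.1 * z.2) := by fun_prop
  let f : G → ℝ := fun y => ∫ k : H, f₀ ((k : G)⁻¹ * y * k) ∂Measure.haar
  have hsupp : ∀ y, f y ≠ 0 → ∃ k : H, f₀ ((k : G)⁻¹ * y * k) ≠ 0 := fun y hy => by
    by_contra! h
    exact hy (by simp [f, h])
  have hfV : ∀ y, f y ≠ 0 → y ∈ V := fun y hy => by
    obtain ⟨k, hk⟩ := hsupp y hy
    have hkV : (k : G)⁻¹ * y * k ∈ V := by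
      by_contra h
      exact hk (hf₀0 fun h' => h (interior_subset h'))
    rw [← hconj V hV k k.2] at hkV
    obtain ⟨z, hz, hzy⟩ := hkV
    simpa using (mul_left_cancel (mul_right_cancel hzy)) ▸ hz
  refine ⟨f, ?_, ?_, fun y => integral_nonneg fun k => (hf₀I _).1, ?_, fun h y => ?_,
    fun y t hy hyt => ?_⟩
  · have := continuousOn_integral_of_compact_support (μ := Measure.haar (G := H)) (s := Set.univ)
      (f := fun (y : G) (k : H) => f₀ ((k : G)⁻¹ * y * k)) isCompact_univ hF.continuousOn (by simp)
    exact continuousOn_univ.1 this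
  · have hK : IsCompact ((fun z : H × G => (z.1 : G) * z.2 * (z.1 : G)⁻¹) ''
        (Set.univ ×ˢ tsupport f₀)) :=
      (isCompact_univ.prod hf₀c).image (by fun_prop)
    refine HasCompactSupport.intro hK fun y hy => ?_
    by_contra h
    obtain ⟨k, hk⟩ := hsupp y h
    exact hy ⟨(k, _), ⟨trivial, subset_tsupport _ hk⟩, by group⟩
  · have h1 : f₀ 1 = 1 := hf₀1 rfl
    simp [f, h1, measureReal_eq_zero_iff, IsOpen.measure_ne_zero]
  · have := integral_mul_left_eq_self (μ := Measure.haar (G := H))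
      (fun k : H => f₀ ((k : G)⁻¹ * (h * y * (h : G)⁻¹) * k)) h
    refine this.symm.trans ?_
    simp [f, mul_assoc]
  · have := @hW₁' (y, y * t) ⟨hVW (hfV y hy), hVW (hfV _ hyt)⟩
    simpa using this

/-- For every neighbourhood `W` of the identity of `H`, there is a probability density `m`
supported in `W` such that, for all continuous `v`, the right translates of `v` averaged
against `m` extend to a function in `B_p(G)`. -/
lemma exists_density_extend (p : ℝ≥0∞) (hp : 1 < p) (H : Subgroup G) [CompactSpace H]
    (hH : IsSIN H) {W : Set H} (hW : W ∈ 𝓝 1) :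
    ∃ m : H → ℝ, Continuous m ∧ 0 ≤ m ∧ ∫ h, m h ∂Measure.haar = 1 ∧ (∀ h, m h ≠ 0 → h ∈ W) ∧
      ∀ v : H → ℂ, Continuous v → ∃ u ∈ Bp p G, ∀ k : H,
        u k = ∫ h, (m h : ℂ) * v (k * h) ∂Measure.haar := by
  obtain ⟨W', hW', hWW'⟩ := mem_nhds_subtype _ _ _ |>.1 hW
  obtain ⟨f, hf, hfc, hf0, hf1, hconj, hfW⟩ := exists_conj_invariant_bump H hH hW'
  let M : H → ℝ := fun t => ∫ y, f y * f (y * t) ∂Measure.haar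
  have hcs : ∀ t : G, HasCompactSupport fun y => f y * f (y * t) := fun t => hfc.mul_right
  have hM : Continuous M := by
    refine continuousOn_univ.1 (continuousOn_integral_of_compact_support hfc (by fun_prop) ?_)
    intro t y _ hy
    simp [image_eq_zero_of_notMem_tsupport hy]
  have hM0 : 0 ≤ M := fun t => integral_nonneg fun y => mul_nonneg (hf0 _) (hf0 _)
  have hM1 : M 1 ≠ 0 := by
    refine (Continuous.integral_pos_of_hasCompactSupport_nonneg_nonzero (x := 1) (by fun_prop)
      (hcs _) (fun y => mul_nonneg (hf0 _) (hf0 _)) ?_).ne'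
    simpa using hf1
  have hMW : ∀ h, M h ≠ 0 → h ∈ W := fun h hh => by
    by_contra hhW
    refine hh (integral_eq_zero_of_ae (.of_forall fun y => ?_))
    by_contra hy
    exact hhW (hWW' (hfW y h (left_ne_zero_of_mul hy) (right_ne_zero_of_mul hy)))
  -- `M` is a class function, because `f` and the Haar measure of `G` are invariant under
  -- conjugation by `H`
  have hMc : ∀ k t : H, M (k * t * k⁻¹) = M t := fun k t => by
    refine (integral_conj_eq_self hf hfc hf0 hf1 (hconj k) (by fun_prop) (hcs _)).symm.trans ?_
    refine integral_congr_ae (.of_forall fun y => ?_)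
    simp only
    rw [hconj, ← hconj k (y * t)]
    simp [mul_assoc]
  have hC : 0 < ∫ h, M h ∂Measure.haar :=
    hM.integral_pos_of_hasCompactSupport_nonneg_nonzero (HasCompactSupport.of_compactSpace M)
      hM0 hM1
  set C := ∫ h, M h ∂Measure.haar
  refine ⟨fun h => C⁻¹ * M h, by fun_prop, fun h => mul_nonneg (inv_nonneg.2 hC.le) (hM0 h), ?_,
    fun h hh => hMW h (right_ne_zero_of_mul hh), fun v hv => ?_⟩
  · rw [integral_const_mul, inv_mul_cancel₀ hC.ne']
  let a : G → ℂ := fun z => ∫ h : H, (f (z * h) : ℂ) * v h ∂Measure.haar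
  have ha : Continuous a := by
    refine continuousOn_univ.1 (continuousOn_integral_of_compact_support isCompact_univ
      (by fun_prop) (by simp))
  have hac : HasCompactSupport a := by
    have hK : IsCompact ((fun z : G × H => z.1 * (z.2 : G)⁻¹) '' (tsupport f ×ˢ Set.univ)) :=
      (hfc.prod isCompact_univ).image (by fun_prop)
    refine HasCompactSupport.intro hK fun y hy => ?_
    refine integral_eq_zero_of_ae (.of_forall fun h => ?_)
    by_contra hh
    have : f (y * h) ≠ 0 := fun h0 => hh (by simp [h0])
    exact hy ⟨(_, h), ⟨subset_tsupport _ this, trivial⟩, by simp⟩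
  refine ⟨_, integral_mul_mem_Bp hp ha hac (b := fun y => ((C⁻¹ * f y : ℝ) : ℂ)) (by fun_prop)
    ((hfc.mul_left (f := fun _ => C⁻¹)).comp_left Complex.ofReal_zero), fun k => ?_⟩
  have hcont : Continuous fun z : G × H =>
      ((C⁻¹ * f z.1 : ℝ) : ℂ) * ((f ((k : G)⁻¹ * z.1 * z.2) : ℂ) * v z.2) := by fun_prop
  calc ∫ y, ((C⁻¹ * f y : ℝ) : ℂ) * a ((k : G)⁻¹ * y) ∂Measure.haar
      = ∫ y, ∫ h : H, ((C⁻¹ * f y : ℝ) : ℂ) * ((f ((k : G)⁻¹ * y * h) : ℂ) * v h)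
          ∂Measure.haar ∂Measure.haar := by
        simp_rw [a, integral_const_mul]
    _ = ∫ h : H, ∫ y, ((C⁻¹ * f y : ℝ) : ℂ) * ((f ((k : G)⁻¹ * y * h) : ℂ) * v h)
          ∂Measure.haar ∂Measure.haar := by
        -- Haar measure on `G` need not be σ-finite, so Fubini is used for `C_c(G × H)`
        refine integral_integral_swap_of_hasCompactSupport hcont ?_
        refine HasCompactSupport.intro (hfc.prod isCompact_univ) fun z hz => ?_
        have : z.1 ∉ tsupport f := fun h => hz ⟨h, trivial⟩
        simp [Function.uncurry, image_eq_zero_of_notMem_tsupport this]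
    _ = ∫ h : H, ((C⁻¹ * M (k⁻¹ * h) : ℝ) : ℂ) * v h ∂Measure.haar := by
        refine integral_congr_ae (.of_forall fun h => ?_)
        have hMh : M (k⁻¹ * h) = M (h * k⁻¹) := by
          rw [← hMc k (k⁻¹ * h)]
          simp
        have hfk : ∀ y, f ((k : G)⁻¹ * y * h) = f (y * (h * (k : G)⁻¹)) := fun y => by
          rw [← hconj k]
          simp [mul_assoc]
        simp only [hMh, hfk, ← mul_assoc, integral_mul_const]
        congr 1
        simp only [M, ← integral_const_mul, ← integral_complex_ofReal]
        simp [mul_assoc]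
    _ = ∫ h : H, ((C⁻¹ * M h : ℝ) : ℂ) * v (k * h) ∂Measure.haar := by
        rw [← integral_mul_left_eq_self _ k]
        simp

end Extension

end FourierStieltjes

/-- Given `v k = φ (π k ξ)` on `H`, the extended function restricts to `k ↦ φ (π k η)` with
`η` an average of the orbit of `ξ` near the identity, so that the difference to `v` is the
coefficient function of the small vector `η - ξ`. -/
theorem mainTheorem3 {G : Type u} [Group G] [TopologicalSpace G] [IsTopologicalGroup G]
    [LocallyCompactSpace G] [T2Space G] [MeasurableSpace G] [BorelSpace G]
    (p : ℝ≥0∞) (hp : 1 < p) (hp' : p < ∞)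
    (H : Subgroup G) [CompactSpace H] (hH : FourierStieltjes.IsSIN H) :
    (∀ u ∈ FourierStieltjes.Bp p G, (fun h : H => u h) ∈ FourierStieltjes.Bp p H) ∧
    ∀ v ∈ FourierStieltjes.Bp p H, ∀ ε : ℝ≥0∞, 0 < ε →
      ∃ u ∈ FourierStieltjes.Bp p G,
        (fun h : H => u h - v h) ∈ FourierStieltjes.Bp p H ∧
        FourierStieltjes.bpNorm p (fun h : H => u h - v h) < ε := by
  refine ⟨?_, ?_⟩
  · rintro u ⟨R, ξ, φ, hu⟩
    exact ⟨FourierStieltjes.QSLRep.restrict R H, ξ, φ, fun h => hu h⟩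
  rintro v ⟨R, ξ, φ, hv⟩ ε hε
  obtain ⟨r, hr, hrε⟩ : ∃ r : ℝ, 0 < r ∧ ENNReal.ofReal r < ε := by
    obtain ⟨r, hr, hrε⟩ := ENNReal.lt_iff_exists_nnreal_btwn.1 hε
    exact ⟨r, by exact_mod_cast hr, by simpa using hrε⟩
  let δ := r / (‖φ‖ + 1)
  have hδ : 0 < δ := by positivity
  obtain ⟨m, hm, hm0, hm1, hmW, hext⟩ := FourierStieltjes.exists_density_extend p hp H hH
    ((R.tendsto_norm_orbit_sub ξ).eventually_le_const hδ)
  have hmi : Integrable m Measure.haar :=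
    hm.integrable_of_hasCompactSupport (HasCompactSupport.of_compactSpace m)
  have hvc : Continuous v := by
    rw [funext hv]
    exact φ.continuous.comp (R.continuous_orbit ξ)
  obtain ⟨u, hu, huv⟩ := hext v hvc
  -- on `H`, the function `u - v` is the coefficient function of `ζ` and `φ`
  let ζ := ∫ k, (m k : ℂ) • R.π k ξ ∂Measure.haar - ξ
  have hζ : ‖ζ‖ ≤ δ := R.norm_integral_smul_sub_le hmi hm0 hm1 ξ hmW
  have hdiff : (fun h : H => u h - v h) = fun k => φ (R.π k ζ) := by
    funext k
    have h := (φ.comp (R.π k).toContinuousLinearEquiv.toContinuousLinearMap).integral_comp_comm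
      (R.integrable_smul_orbit (f := fun k => (m k : ℂ)) hmi.ofReal ξ)
    simp only [ζ, map_sub, huv, hv, map_mul]
    congr 1
    simpa using h
  refine ⟨u, hu, ⟨R, ζ, φ, congrFun hdiff⟩, ?_⟩
  rw [hdiff]
  refine (FourierStieltjes.bpNorm_coeff_le R ζ φ).trans_lt
    ((ENNReal.ofReal_le_ofReal ?_).trans_lt hrε)
  calc ‖ζ‖ * ‖φ‖ ≤ δ * (‖φ‖ + 1) := by gcongr; linarith
    _ = r := div_mul_cancel₀ _ (by positivity)
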